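/- **Corollary (The quantitative wedge-of-the-edge theorem).** A *real operator system* is a real linear subspace $R$, containing $1$, of the self-adjoint elements of a unital $C^*$-algebra $A$. For $n\in\mathbb N$ let $\mathcal M(R)_n=M_n(\mathbb C)\otimes_{\mathbb R}R$, regarded as the space of $n\times n$ matrices with entries in $\mathbb C\otimes R=R+iR\subseteq A$, with the norm and the order inherited from the $C^*$-algebra $M_n(A)$; let $\mathcal M(R)=\bigcup_n\mathcal M(R)_n$ and let $\mathcal S(R)$ be the set of its self-adjoint elements. A *positive contraction* is an element $X$ with $X\ge 0$ and $\|X\|\le 1$. A function $f$ from a set $G\subseteq\mathcal M(R_1)$ to $\mathcal M(R_2)$ is *free* if it maps $G\cap\mathcal M(R_1)_n$ into $\mathcal M(R_2)_n$ and satisfies $f(X\oplus Y)=f(X)\oplus f(Y)$ and $f(S^{-1}XS)=S^{-1}f(X)S$ for invertible complex matrices $S$, whenever all arguments lie in $G$. There are universal constants $\delta,\varepsilon>0$ such that the following two statements hold. 1. *(Commutative case.)* Let $R_1$ be a real operator system and $R_2$ a real linear subspace of a complex Banach space $E$. For each $d\ge 0$ let $h_d:R_1\to R_2$ be a generalized homogeneous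 polynomial of degree $d$, i.e. for all $x_1,\dots,x_k\in R_1$ the function $t\mapsto h_d(\sum_i t_ix_i)$ on $\mathbb R^k$ is a homogeneous polynomial of degree $d$ with vector coefficients. Suppose $\sum_d\|h_d(X)\|\le 1$ for every positive contraction $X\in R_1$. Then each $h_d$ has a unique extension, also denoted $h_d$, to a complex generalized homogeneous polynomial $R_1+iR_1\to E$ of degree $d$. On the ball $B_{\mathbb C}(0,\delta)=\{Z\in R_1+iR_1:\|Z\|<\delta\}$ the series $\sum_d h_d(Z)$ converges absolutely and uniformly, and its sum is a complex analytic function with values in the closed complex span of $R_2$, of norm at most $\varepsilon$. 2. *(Noncommutative case.)* Let $R_1,R_2$ be real operator systems. For each $d\ge 0$ let $h_d:\mathcal M(R_1)\to\mathcal M(R_2)$ be a noncommutative generalized homogeneous polynomial of degree $d$, i.e. a free function such that for all $x_1,\dots,x_k\in R_1$ there are coefficients $c_w\in\mathbb C\otimes R_2$, indexed by the words $w$ of length $d$ in $k$ letters, with $h_d(\sum_iT_i\otimes x_i)=\sum_{|w|=d}T^w\otimes c_w$ for all $n$ and all $T_1,\dots,T_k\in M_n(\mathbb C)$. Suppose $\sum_d\|h_d(X)\|\le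 1$ for every positive contraction $X\in\mathcal S(R_1)$. Then on $B_{\mathbb C}(0,\delta)=\bigcup_n\{Z\in\mathcal M(R_1)_n:\|Z\|<\delta\}$ the series $\sum_d h_d(Z)$ converges absolutely, and uniformly over all $n$ simultaneously, and its sum is a noncommutative analytic function (a free function into $\mathcal M(\overline{R_2})$ that is complex analytic on each level $n$) of norm at most $\varepsilon$. -/

import Mathlib

noncomputable section

namespace WedgeOfEdge

/-- A real operator system in a unital C⋆-algebra `A`: a real subspace of self-adjoint elements
that contains `1`. It need not be closed. -/
structure IsRealOperatorSystem {A : Type*} [CStarAlgebra A] (R : Submodule ℝ A) : Prop where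
  one_mem : (1 : A) ∈ R
  isSelfAdjoint : ∀ x ∈ R, IsSelfAdjoint x

/-- The complex span of a real subspace. If `R` consists of self-adjoint elements, then
`R ∩ iR = 0`, so that this is the complexification `ℂ ⊗ R = R + iR`. -/
def cspan {E : Type*} [NormedAddCommGroup E] [NormedSpace ℂ E] (R : Submodule ℝ E) :
    Submodule ℂ E :=
  Submodule.span ℂ (R : Set E)

/-- The inclusion of `R` into its complexification. -/
def toCspan {E : Type*} [NormedAddCommGroup E] [NormedSpace ℂ E] (R : Submodule ℝ E) (x : R) :
    cspan R :=
  ⟨(x : E), Submodule.subset_span x.2⟩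

/-! ### Commutative polynomials -/

/-- Generalized homogeneous polynomials of degree `d` over `𝕜`: functions whose restriction to
(the span of) any finite family of vectors is a homogeneous polynomial of degree `d` in the
coordinates, with vector coefficients. -/
def IsGenHomPoly (𝕜 : Type*) [Field 𝕜] {V E : Type*} [AddCommGroup V] [Module 𝕜 V]
    [AddCommGroup E] [Module 𝕜 E] (d : ℕ) (h : V → E) : Prop :=
  ∀ (k : ℕ) (x : Fin k → V), ∃ c : (Fin k → ℕ) → E, ∀ t : Fin k → 𝕜,
    h (∑ i, t i • x i) =
      ∑ α ∈ Finset.piAntidiag (Finset.univ : Finset (Fin k)) d, (∏ i, t i ^ α i) • c α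

/-- `H` is the complexification of `h`: a complex generalized homogeneous polynomial of degree `d`
on `R + iR` that agrees with `h` on `R`. -/
structure IsComplexification {A E : Type*} [NormedAddCommGroup A] [NormedSpace ℂ A]
    [NormedAddCommGroup E] [NormedSpace ℂ E] {R : Submodule ℝ A} (d : ℕ)
    (h : R → E) (H : cspan R → E) : Prop where
  isGenHomPoly : IsGenHomPoly ℂ d H
  agree : ∀ x : R, H (toCspan R x) = h x

/-! ### The matrix universe and free functions -/

section Matrices

variable {A : Type*}

/-- The elementary tensor `T ⊗ a`, as the matrix with entries `T i j • a`. -/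
def tens [SMul ℂ A] {n : ℕ} (T : Matrix (Fin n) (Fin n) ℂ) (a : A) :
    CStarMatrix (Fin n) (Fin n) A :=
  CStarMatrix.ofMatrix (T.map fun t => t • a)

/-- The direct sum `X ⊕ Y`, as a block diagonal matrix. -/
def dsum [Zero A] {m n : ℕ} (X : CStarMatrix (Fin m) (Fin m) A)
    (Y : CStarMatrix (Fin n) (Fin n) A) : CStarMatrix (Fin (m + n)) (Fin (m + n)) A :=
  CStarMatrix.ofMatrix (Matrix.reindex finSumFinEquiv finSumFinEquiv
    (Matrix.fromBlocks (CStarMatrix.ofMatrix.symm X) 0 0 (CStarMatrix.ofMatrix.symm Y)))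

/-- The similarity `S⁻¹ X S` by an invertible complex matrix `S`. -/
def conj [CStarAlgebra A] {n : ℕ} (S : GL (Fin n) ℂ) (X : CStarMatrix (Fin n) (Fin n) A) :
    CStarMatrix (Fin n) (Fin n) A :=
  tens ((S⁻¹ : GL (Fin n) ℂ) : Matrix (Fin n) (Fin n) ℂ) 1 * X *
    tens (S : Matrix (Fin n) (Fin n) ℂ) 1

/-- The level `M_n(ℂ) ⊗ R` of the matrix universe over `R`, realized as the space of
`n × n` matrices with entries in `R + iR`. -/
def matUniv [CStarAlgebra A] (R : Submodule ℝ A) (n : ℕ) :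
    Submodule ℂ (CStarMatrix (Fin n) (Fin n) A) where
  carrier := {X | ∀ i j, X i j ∈ cspan R}
  add_mem' := fun hX hY i j => (cspan R).add_mem (hX i j) (hY i j)
  zero_mem' := fun _ _ => (cspan R).zero_mem
  smul_mem' := fun c _ hX i j => (cspan R).smul_mem c (hX i j)

variable {B : Type*}

/-- `f` is a free function on `G ⊆ 𝓜(R₁)` with values in `𝓜(R₂)`. (The values of `f n` outside
`G n` are irrelevant.) -/
structure IsFreeFunction [CStarAlgebra A] [CStarAlgebra B] (R₁ : Submodule ℝ A)
    (R₂ : Submodule ℝ B) (G : ∀ n : ℕ, Set (CStarMatrix (Fin n) (Fin n) A))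
    (f : ∀ n : ℕ, CStarMatrix (Fin n) (Fin n) A → CStarMatrix (Fin n) (Fin n) B) : Prop where
  domain_subset : ∀ n, ∀ X ∈ G n, X ∈ matUniv R₁ n
  maps_to : ∀ n, ∀ X ∈ G n, f n X ∈ matUniv R₂ n
  map_dsum : ∀ m n, ∀ X ∈ G m, ∀ Y ∈ G n, dsum X Y ∈ G (m + n) →
    f (m + n) (dsum X Y) = dsum (f m X) (f n Y)
  map_conj : ∀ n, ∀ X ∈ G n, ∀ S : GL (Fin n) ℂ, conj S X ∈ G n →
    f n (conj S X) = conj S (f n X)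

/-- Noncommutative generalized homogeneous polynomials of degree `d`: free functions on `𝓜(R₁)`
which, for any `x₁, …, x_k ∈ R₁`, are given on `∑ Tᵢ ⊗ xᵢ` by a noncommutative homogeneous
polynomial `∑_{|w| = d} T^w ⊗ c_w` with coefficients `c_w ∈ ℂ ⊗ R₂` that do not depend on the
matrix size. -/
structure IsNCGenHomPoly [CStarAlgebra A] [CStarAlgebra B] (R₁ : Submodule ℝ A)
    (R₂ : Submodule ℝ B) (d : ℕ)
    (h : ∀ n : ℕ, CStarMatrix (Fin n) (Fin n) A → CStarMatrix (Fin n) (Fin n) B) : Prop where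
  free : IsFreeFunction R₁ R₂ (fun n => (matUniv R₁ n : Set _)) h
  poly : ∀ (k : ℕ) (x : Fin k → A), (∀ i, x i ∈ R₁) →
    ∃ c : (Fin d → Fin k) → B, (∀ w, c w ∈ cspan R₂) ∧
      ∀ (n : ℕ) (T : Fin k → Matrix (Fin n) (Fin n) ℂ),
        h n (∑ i, tens (T i) (x i)) =
          ∑ w : Fin d → Fin k, tens (List.ofFn fun j => T (w j)).prod (c w)

variable [CStarAlgebra A] [PartialOrder A] [StarOrderedRing A]

/-- The complex ball `B_ℂ(0, δ)` in `𝓜(R)`, level by level, for the C⋆-norm on matrices. -/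
def ncBall (R : Submodule ℝ A) (δ : ℝ) (n : ℕ) : Set (CStarMatrix (Fin n) (Fin n) A) :=
  {Z | Z ∈ matUniv R n ∧ ‖Z‖ < δ}

/-- The positive contractions in the Hermitian matrix universe `𝓢(R)`, level by level. -/
def ncPosContractions (R : Submodule ℝ A) (n : ℕ) : Set (CStarMatrix (Fin n) (Fin n) A) :=
  {X | X ∈ matUniv R n ∧ 0 ≤ X ∧ ‖X‖ ≤ 1}

/-- A noncommutative analytic function on `G ⊆ 𝓜(R₁)`: a free function that is analytic on each
level, as a function on the complex normed space `M_n(ℂ) ⊗ R₁`. -/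
structure IsNCAnalytic [CStarAlgebra B] [PartialOrder B] [StarOrderedRing B]
    (R₁ : Submodule ℝ A) (R₂ : Submodule ℝ B)
    (G : ∀ n : ℕ, Set (CStarMatrix (Fin n) (Fin n) A))
    (f : ∀ n : ℕ, CStarMatrix (Fin n) (Fin n) A → CStarMatrix (Fin n) (Fin n) B) : Prop where
  free : IsFreeFunction R₁ R₂ G f
  analytic : ∀ n, AnalyticOnNhd ℂ (fun Z : matUniv R₁ n => f n Z) {Z | (Z : CStarMatrix _ _ A) ∈ G n}

end Matrices

end WedgeOfEdge

end

noncomputable section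

namespace WedgeOfEdge

open Finset Complex ComplexStarModule

/-! ### Polarization -/

section Polarization

variable {𝕜 W V E : Type*} [Field 𝕜] [AddCommGroup W] [Module 𝕜 W] [AddCommGroup V] [Module 𝕜 V]
  [AddCommGroup E] [Module 𝕜 E] {d : ℕ}

/-! The proof is polarization with a well-chosen base point. A homogeneous polynomial `h` of degree
`d` is the diagonal of a symmetric `d`-linear map, equal to `1/d!` times the `d`-th finite
difference of `h`. That difference does not depend on its base point (`IsGenHomPoly.polarForm_eq`),
so it may be taken at `1/2 • 1`, the centre of a ball of radius `1/2` of positive contractions. If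
every direction has norm at most `1/(2d)`, then all `2^d` sample points are positive contractions,
where `‖h‖ ≤ 1`. Rescaling and `d^d/d! ≤ e^d` bound the polarization by `(4e)^d`
(`IsRealOperatorSystem.norm_polarization_le`).

Splitting each argument into real and imaginary parts complexifies the multilinear map at the cost
of a factor `2^d`. The complexified polynomials are thus the terms of a power series with
coefficients bounded by `K^d`, `K = 8e`, and on the ball of radius `1/(2K)` they are dominated by
`2^{-d}`. Convergence, analyticity and the bound follow.

In the noncommutative case, the self-adjoint part of each level is itself a real operator system,
inside `M_n(A)`, whose complexification is the whole level (`IsRealOperatorSystem.cspan_hermPart`).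
The same estimate applies there, with constants independent of `n`. Freeness passes to the sum
because direct sums and similarities commute with convergent series. -/

/-- The `d`-th finite difference of `h` at `0` in the directions `x`. -/
def polarForm (h : V → E) (x : Fin d → V) : E :=
  ∑ S : Finset (Fin d), ((-1 : ℤ) ^ #S) • h (∑ i ∈ Sᶜ, x i)

/-- The `d`-th finite difference, at any base point, of the diagonal of a `d`-linear map is the
symmetrization of that map. -/
theorem sum_neg_one_pow_smul_diagonal (N : MultilinearMap 𝕜 (fun _ : Fin d => W) E) (b : W)
    (x : Fin d → W) :
    ∑ S : Finset (Fin d), ((-1 : ℤ) ^ #S) • N (fun _ => b + ∑ i ∈ Sᶜ, x i) =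
      (∑ σ : Equiv.Perm (Fin d), N.domDomCongr σ) x := by
  classical
  -- The letter `none` stands for the base point. `U r` is the set of directions that the word `r`
  -- omits, and `r` survives in the term of `S` exactly when `S ⊆ U r`.
  let v : Option (Fin d) → W := fun o => o.elim b x
  let s : Finset (Fin d) → Option (Fin d) → 𝕜 := fun S o => o.elim 1 fun i => if i ∈ S then 0 else 1
  let U : (Fin d → Option (Fin d)) → Finset (Fin d) := fun r => {i | ∀ j, r j ≠ some i}
  have expand (S : Finset (Fin d)) : N (fun _ => b + ∑ i ∈ Sᶜ, x i) =
      ∑ r : Fin d → Option (Fin d), if S ∈ (U r).powerset then N (fun j => v (r j)) else 0 := by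
    have h1 : b + ∑ i ∈ Sᶜ, x i = ∑ o, s S o • v o := by
      rw [Fintype.sum_option]
      simp only [s, v, Option.elim, one_smul, ite_smul, zero_smul]
      simp_rw [← ite_not (_ ∈ S)]
      rw [← Finset.sum_filter]
      congr 2
      ext i; simp
    simp only [h1]
    rw [N.map_sum]
    refine Finset.sum_congr rfl fun r _ => ?_
    rw [N.map_smul_univ]
    split_ifs with hS
    · rw [Finset.prod_eq_one, one_smul]
      intro j _
      cases hj : r j with
      | none => rfl
      | some i =>
        have : i ∉ S := fun hi => by
          have := mem_powerset.1 hS hi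
          simp only [U, mem_filter, mem_univ, true_and] at this
          exact this j hj
        simp [s, this]
    · rw [mem_powerset, Finset.not_subset] at hS
      obtain ⟨i, hi, hU⟩ := hS
      simp only [U, mem_filter, mem_univ, true_and, not_forall, not_not] at hU
      obtain ⟨j, hj⟩ := hU
      rw [Finset.prod_eq_zero (mem_univ j) (by simp [s, hj, hi]), zero_smul]
  simp only [expand, Finset.smul_sum]
  rw [Finset.sum_comm]
  -- The alternating sum over the subsets of `U r` vanishes unless `U r` is empty. A word of length
  -- `d` that uses all `d` directions is a permutation, so it has no room for the base point.
  have inner (r : Fin d → Option (Fin d)) :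
      ∑ S : Finset (Fin d), ((-1 : ℤ) ^ #S) •
        (if S ∈ (U r).powerset then N (fun j => v (r j)) else 0) =
      if U r = ∅ then N (fun j => v (r j)) else 0 := by
    simp only [smul_ite, smul_zero]
    rw [← Finset.sum_filter, Finset.filter_mem_eq_inter, Finset.univ_inter, ← Finset.sum_smul,
      Finset.sum_powerset_neg_one_pow_card]
    split_ifs <;> simp
  simp only [inner]
  rw [← Finset.sum_filter, _root_.sum_apply]
  symm
  refine Finset.sum_bij (fun σ _ j => some (σ j)) ?_ ?_ ?_ ?_
  · intro σ _
    simp only [mem_filter, mem_univ, true_and, U, ne_eq, Option.some.injEq,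
      Finset.filter_eq_empty_iff, not_forall, not_not]
    exact fun i _ => ⟨σ.symm i, by simp⟩
  · intro σ _ τ _ h
    ext j
    simpa using congrArg Fin.val (Option.some.inj (congrFun h j))
  · intro r hr
    simp only [mem_filter, mem_univ, true_and, U, ne_eq,
      Finset.filter_eq_empty_iff, not_forall, not_not, forall_const] at hr
    replace hr : ∀ i, ∃ j, r j = some i := fun i => hr (x := i)
    choose j hj using hr
    have hinj : Function.Injective j := fun a b hab => by
      have := hj a
      rw [hab, hj b] at this
      exact (Option.some.inj this).symm
    let e := Equiv.ofBijective j (Finite.injective_iff_bijective.1 hinj)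
    refine ⟨e.symm, mem_univ _, ?_⟩
    ext1 k
    have := hj (e.symm k)
    rw [show j (e.symm k) = k from e.apply_symm_apply k] at this
    exact this.symm
  · intro σ _
    rfl

/-- A generalized homogeneous polynomial is, in the coordinates of a finite family of vectors,
the diagonal of a multilinear map. -/
theorem IsGenHomPoly.exists_multilinearMap {h : V → E} (hh : IsGenHomPoly 𝕜 d h)
    {ι : Type*} [Fintype ι] (v : ι → V) :
    ∃ N : MultilinearMap 𝕜 (fun _ : Fin d => ι → 𝕜) E,
      ∀ t, h (Fintype.linearCombination 𝕜 v t) = N (fun _ => t) := by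
  classical
  let e := Fintype.equivFin ι
  obtain ⟨c, hc⟩ := hh _ (v ∘ e.symm)
  -- A monomial of degree `d` is the diagonal of a product of `d` coordinate functionals, the `i`-th
  -- repeated `α i` times.
  have word (α : Fin (Fintype.card ι) → ℕ) (hα : ∑ i, α i = d) :
      ∃ m : MultilinearMap 𝕜 (fun _ : Fin d => ι → 𝕜) 𝕜, ∀ t : ι → 𝕜,
        m (fun _ => t) = ∏ i, t (e.symm i) ^ α i := by
    subst hα
    refine ⟨(MultilinearMap.mkPiAlgebra 𝕜 _ 𝕜).compLinearMap
      fun j => LinearMap.proj (e.symm (finSigmaFinEquiv.symm j).1), fun t => ?_⟩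
    simp only [MultilinearMap.compLinearMap_apply,
      MultilinearMap.mkPiAlgebra_apply, LinearMap.proj_apply]
    rw [← Equiv.prod_comp finSigmaFinEquiv]
    simp [Fintype.prod_sigma]
  choose! m hm using word
  refine ⟨∑ α ∈ Finset.piAntidiag univ d, (m α).smulRight (c α), fun t => ?_⟩
  have h1 : Fintype.linearCombination 𝕜 v t = ∑ i, (t ∘ e.symm) i • (v ∘ e.symm) i := by
    rw [Fintype.linearCombination_apply, ← Equiv.sum_comp e.symm]
    rfl
  rw [h1, hc, _root_.sum_apply]
  refine Finset.sum_congr rfl fun α hα => ?_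
  rw [MultilinearMap.smulRight_apply, hm α (by simpa using hα)]
  rfl

theorem IsGenHomPoly.exists_multilinearMap_sum {h : V → E} (hh : IsGenHomPoly 𝕜 d h)
    {ι : Type*} [Fintype ι] (v : ι → V) :
    ∃ N : MultilinearMap 𝕜 (fun _ : Fin d => ι → 𝕜) E,
      ∀ (b : ι → 𝕜) (a : Fin d → ι → 𝕜),
        ∑ S : Finset (Fin d), ((-1 : ℤ) ^ #S) • h (Fintype.linearCombination 𝕜 v b +
          ∑ i ∈ Sᶜ, Fintype.linearCombination 𝕜 v (a i)) = N a := by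
  obtain ⟨N, hN⟩ := hh.exists_multilinearMap v
  refine ⟨∑ σ : Equiv.Perm (Fin d), N.domDomCongr σ, fun b a => ?_⟩
  simp only [← map_sum, ← map_add, hN]
  exact sum_neg_one_pow_smul_diagonal N b a

/-- Degree `d` is exhausted by the `d` directions, so the base point drops out. This freedom lets
every sample point be moved into the positive contractions. -/
theorem IsGenHomPoly.polarForm_eq {h : V → E} (hh : IsGenHomPoly 𝕜 d h) (b : V) (x : Fin d → V) :
    polarForm h x = ∑ S : Finset (Fin d), ((-1 : ℤ) ^ #S) • h (b + ∑ i ∈ Sᶜ, x i) := by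
  classical
  obtain ⟨N, hN⟩ := hh.exists_multilinearMap_sum (fun o : Option (Fin d) => o.elim b x)
  have h0 := hN 0 fun i => Pi.single (some i) 1
  have h1 := hN (Pi.single none 1) fun i => Pi.single (some i) 1
  simp only [map_zero, zero_add, Fintype.linearCombination_apply_single, one_smul,
    Option.elim] at h0 h1
  rw [polarForm, h0, h1]

/-- The polar form as a multilinear map. -/
def polarMap (h : V → E) (hh : IsGenHomPoly 𝕜 d h) : MultilinearMap 𝕜 (fun _ : Fin d => V) E where
  toFun := polarForm h
  map_update_add' := by
    intro inst x i y z
    have : inst = instDecidableEqFin d := Subsingleton.elim _ _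
    subst this
    -- In coordinates for `x`, `y` and `z` together, the polar form is the multilinear map `N`, and
    -- additivity is read off there.
    obtain ⟨N, hN⟩ := hh.exists_multilinearMap_sum (Sum.elim x ![y, z])
    have hL (a : Fin d → (Fin d ⊕ Fin 2) → 𝕜) : polarForm h
        (fun i => Fintype.linearCombination 𝕜 (Sum.elim x ![y, z]) (a i)) = N a := by
      simpa [polarForm] using hN 0 a
    have hu (p : (Fin d ⊕ Fin 2) → 𝕜) :
        polarForm h (Function.update x i (Fintype.linearCombination 𝕜 (Sum.elim x ![y, z]) p)) =
          N (Function.update (fun i => Pi.single (Sum.inl i) 1) i p) := by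
      rw [← hL]
      congr 1
      ext j
      rcases eq_or_ne j i with rfl | hj
      · simp
      · simp [hj]
    have hy := hu (Pi.single (Sum.inr 0) 1)
    have hz := hu (Pi.single (Sum.inr 1) 1)
    have hyz := hu (Pi.single (Sum.inr 0) 1 + Pi.single (Sum.inr 1) 1)
    rw [N.map_update_add, ← hy, ← hz] at hyz
    simpa using hyz
  map_update_smul' := by
    intro inst x i c y
    have : inst = instDecidableEqFin d := Subsingleton.elim _ _
    subst this
    obtain ⟨N, hN⟩ := hh.exists_multilinearMap_sum (Sum.elim x ![y])
    have hL (a : Fin d → (Fin d ⊕ Fin 1) → 𝕜) : polarForm h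
        (fun i => Fintype.linearCombination 𝕜 (Sum.elim x ![y]) (a i)) = N a := by
      simpa [polarForm] using hN 0 a
    have hu (p : (Fin d ⊕ Fin 1) → 𝕜) :
        polarForm h (Function.update x i (Fintype.linearCombination 𝕜 (Sum.elim x ![y]) p)) =
          N (Function.update (fun i => Pi.single (Sum.inl i) 1) i p) := by
      rw [← hL]
      congr 1
      ext j
      rcases eq_or_ne j i with rfl | hj
      · simp
      · simp [hj]
    have hy := hu (Pi.single (Sum.inr 0) 1)
    have hcy := hu (c • Pi.single (Sum.inr 0) 1)
    rw [N.map_update_smul, ← hy, map_smul] at hcy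
    simpa using hcy

theorem IsGenHomPoly.polarForm_diagonal {h : V → E} (hh : IsGenHomPoly 𝕜 d h) (x : V) :
    polarForm h (fun _ : Fin d => x) = (d.factorial : 𝕜) • h x := by
  obtain ⟨N, hN⟩ := hh.exists_multilinearMap (fun _ : Unit => x)
  have key := sum_neg_one_pow_smul_diagonal N 0 (fun _ _ => 1)
  have h1 : h x = N (fun _ _ => 1) := by
    rw [← hN]; simp [Fintype.linearCombination_apply]
  have h2 (S : Finset (Fin d)) : h (∑ i ∈ Sᶜ, x) =
      N (fun _ => 0 + ∑ i ∈ Sᶜ, (fun _ => 1)) := by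
    rw [← hN]; simp [Fintype.linearCombination_apply, Nat.cast_smul_eq_nsmul]
  rw [polarForm, h1]
  simp only [h2]
  rw [key, _root_.sum_apply]
  simp [MultilinearMap.domDomCongr_apply, Fintype.card_perm, Nat.cast_smul_eq_nsmul]

/-- The symmetric multilinear map with diagonal `h`. -/
def polarization (h : V → E) (hh : IsGenHomPoly 𝕜 d h) :
    MultilinearMap 𝕜 (fun _ : Fin d => V) E :=
  (d.factorial : 𝕜)⁻¹ • polarMap h hh

theorem polarization_apply {h : V → E} (hh : IsGenHomPoly 𝕜 d h) (x : Fin d → V) :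
    polarization h hh x = (d.factorial : 𝕜)⁻¹ • polarForm h x := rfl

theorem polarization_diagonal [CharZero 𝕜] {h : V → E} (hh : IsGenHomPoly 𝕜 d h) (x : V) :
    polarization h hh (fun _ => x) = h x := by
  rw [polarization_apply, hh.polarForm_diagonal,
    inv_smul_smul₀ (Nat.cast_ne_zero.2 d.factorial_ne_zero)]

/-- A finite sum with the weights `∏ j, t (w a j)` of words `w a` of length `d` is a homogeneous
polynomial of degree `d`. -/
theorem exists_coeff_of_sum_words {ι : Type*} [Fintype ι] {k : ℕ} (w : ι → Fin d → Fin k)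
    (C : ι → E) :
    ∃ c : (Fin k → ℕ) → E, ∀ t : Fin k → 𝕜, ∑ a, (∏ j, t (w a j)) • C a =
      ∑ α ∈ Finset.piAntidiag (Finset.univ : Finset (Fin k)) d, (∏ i, t i ^ α i) • c α := by
  classical
  let cnt : ι → Fin k → ℕ := fun a i => #{j | w a j = i}
  refine ⟨fun α => ∑ a with cnt a = α, C a, fun t => ?_⟩
  have hmap : ∀ a ∈ (univ : Finset ι), cnt a ∈ Finset.piAntidiag univ d := by
    intro a _
    rw [mem_piAntidiag]
    refine ⟨?_, fun i _ => mem_univ i⟩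
    have := Finset.card_eq_sum_card_fiberwise (s := (univ : Finset (Fin d)))
      (t := (univ : Finset (Fin k))) (f := w a) (fun _ _ => by simp)
    simpa [cnt] using this.symm
  rw [← Finset.sum_fiberwise_of_maps_to hmap]
  refine Finset.sum_congr rfl fun α _ => ?_
  rw [Finset.smul_sum]
  refine Finset.sum_congr rfl fun a ha => ?_
  rw [← (mem_filter.1 ha).2]
  congr 1
  rw [← Finset.prod_fiberwise (s := univ) (g := w a)]
  refine Finset.prod_congr rfl fun i _ => ?_
  rw [Finset.prod_congr rfl (g := fun _ => t i) (fun j hj => by rw [(mem_filter.1 hj).2]),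
    Finset.prod_const]

/-- The diagonal of a multilinear map is a generalized homogeneous polynomial. -/
theorem isGenHomPoly_diagonal (N : MultilinearMap 𝕜 (fun _ : Fin d => V) E) :
    IsGenHomPoly 𝕜 d (fun x => N fun _ => x) := by
  classical
  intro k x
  obtain ⟨c, hc⟩ := exists_coeff_of_sum_words (𝕜 := 𝕜) (id : (Fin d → Fin k) → _)
    (fun w => N fun j => x (w j))
  refine ⟨c, fun t => ?_⟩
  rw [← hc]
  refine (N.map_sum fun _ i => t i • x i).trans ?_
  exact Finset.sum_congr rfl fun w _ => N.map_smul_univ (fun j => t (w j)) fun j => x (w j)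

end Polarization

/-! ### Real operator systems and their complexification -/

section OperatorSystem

variable {A : Type*} [CStarAlgebra A] {R : Submodule ℝ A}

theorem mem_cspan_of_mem {E : Type*} [NormedAddCommGroup E] [NormedSpace ℂ E]
    {R : Submodule ℝ E} {x : E} (hx : x ∈ R) : x ∈ cspan R :=
  Submodule.subset_span hx

theorem IsRealOperatorSystem.mem_cspan_iff (hR : IsRealOperatorSystem R) {z : A} :
    z ∈ cspan R ↔ (ℜ z : A) ∈ R ∧ (ℑ z : A) ∈ R := by
  constructor
  · intro hz
    induction hz using Submodule.span_induction with
    | mem x hx =>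
      have := hR.isSelfAdjoint x hx
      rw [this.coe_realPart, this.imaginaryPart]
      exact ⟨hx, R.zero_mem⟩
    | zero => simp
    | add x y _ _ hx hy =>
      simp only [map_add, AddSubgroup.coe_add]
      exact ⟨R.add_mem hx.1 hy.1, R.add_mem hx.2 hy.2⟩
    | smul c x _ hx =>
      rw [realPart_smul, imaginaryPart_smul]
      exact ⟨R.sub_mem (R.smul_mem _ hx.1) (R.smul_mem _ hx.2),
        R.add_mem (R.smul_mem _ hx.2) (R.smul_mem _ hx.1)⟩
  · rintro ⟨h1, h2⟩
    rw [← realPart_add_I_smul_imaginaryPart z]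
    exact (cspan R).add_mem (mem_cspan_of_mem h1)
      ((cspan R).smul_mem _ (mem_cspan_of_mem h2))

/-- The real part, as a map from `R + iR` to `R`. -/
def IsRealOperatorSystem.re (hR : IsRealOperatorSystem R) : cspan R →ₗ[ℝ] R where
  toFun z := ⟨(ℜ (z : A) : A), (hR.mem_cspan_iff.1 z.2).1⟩
  map_add' x y := by ext; simp
  map_smul' c x := by ext; simp

/-- The imaginary part, as a map from `R + iR` to `R`. -/
def IsRealOperatorSystem.im (hR : IsRealOperatorSystem R) : cspan R →ₗ[ℝ] R where
  toFun z := ⟨(ℑ (z : A) : A), (hR.mem_cspan_iff.1 z.2).2⟩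
  map_add' x y := by ext; simp
  map_smul' c x := by ext; simp

variable (hR : IsRealOperatorSystem R)

theorem IsRealOperatorSystem.re_I_smul (z : cspan R) : hR.re (I • z) = -hR.im z := by
  ext; simp [IsRealOperatorSystem.re, IsRealOperatorSystem.im, realPart_I_smul]

theorem IsRealOperatorSystem.im_I_smul (z : cspan R) : hR.im (I • z) = hR.re z := by
  ext; simp [IsRealOperatorSystem.re, IsRealOperatorSystem.im, imaginaryPart_I_smul]

theorem IsRealOperatorSystem.norm_re_le (z : cspan R) : ‖hR.re z‖ ≤ ‖z‖ :=
  realPart.norm_le (z : A)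

theorem IsRealOperatorSystem.norm_im_le (z : cspan R) : ‖hR.im z‖ ≤ ‖z‖ :=
  imaginaryPart.norm_le (z : A)

theorem IsRealOperatorSystem.re_toCspan (x : R) : hR.re (toCspan R x) = x := by
  ext; exact (hR.isSelfAdjoint x x.2).coe_realPart

theorem IsRealOperatorSystem.im_toCspan (x : R) : hR.im (toCspan R x) = 0 := by
  ext
  change ((ℑ (x : A) : selfAdjoint A) : A) = 0
  rw [(hR.isSelfAdjoint x x.2).imaginaryPart]
  rfl

theorem IsRealOperatorSystem.toCspan_re_add (z : cspan R) :
    toCspan R (hR.re z) + I • toCspan R (hR.im z) = z := by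
  ext; exact realPart_add_I_smul_imaginaryPart (z : A)

variable {E : Type*} [NormedAddCommGroup E] [NormedSpace ℂ E] {d : ℕ}

/-- The complexification of a real multilinear map, as a real multilinear map. -/
def IsRealOperatorSystem.complexifyAux (M : MultilinearMap ℝ (fun _ : Fin d => R) E) :
    MultilinearMap ℝ (fun _ : Fin d => cspan R) E :=
  ∑ S : Finset (Fin d), ((I : ℂ) ^ #S) •
    M.compLinearMap (fun i => if i ∈ S then hR.im else hR.re)

theorem IsRealOperatorSystem.complexifyAux_apply (M : MultilinearMap ℝ (fun _ : Fin d => R) E)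
    (z : Fin d → cspan R) : hR.complexifyAux M z =
      ∑ S : Finset (Fin d), ((I : ℂ) ^ #S) •
        M (fun i => if i ∈ S then hR.im (z i) else hR.re (z i)) := by
  simp only [complexifyAux, _root_.sum_apply, _root_.smul_apply,
    MultilinearMap.compLinearMap_apply]
  refine Finset.sum_congr rfl fun S _ => ?_
  congr 2
  ext1 i
  split_ifs <;> rfl

/-- Multiplication by `I` in slot `j` exchanges real and imaginary parts up to sign. This matches
the term of `S` with that of `S` with `j` toggled; the power of `I` changes by one, and `I² = -1`
absorbs the sign. -/
theorem IsRealOperatorSystem.complexifyAux_update_I_smul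
    (M : MultilinearMap ℝ (fun _ : Fin d => R) E) (z : Fin d → cspan R) (j : Fin d) (y : cspan R) :
    hR.complexifyAux M (Function.update z j (I • y)) =
      I • hR.complexifyAux M (Function.update z j y) := by
  rw [complexifyAux_apply, complexifyAux_apply, Finset.smul_sum]
  have hinv : Function.Involutive (fun S : Finset (Fin d) => symmDiff S {j}) :=
    fun S => symmDiff_symmDiff_cancel_right _ _
  refine Fintype.sum_equiv hinv.toPerm _ _ fun S => ?_
  by_cases hj : j ∈ S
  · have hS : Function.Involutive.toPerm _ hinv S = S.erase j := by
      rw [Function.Involutive.coe_toPerm]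
      ext i; simp only [Finset.mem_symmDiff, mem_singleton, mem_erase]; grind
    rw [hS, smul_smul, ← pow_succ', Finset.card_erase_add_one hj]
    congr 2
    ext1 i
    rcases eq_or_ne i j with rfl | hi
    · simp [hj, im_I_smul]
    · simp [hi]
  · have hS : Function.Involutive.toPerm _ hinv S = insert j S := by
      rw [Function.Involutive.coe_toPerm]
      ext i; simp only [Finset.mem_symmDiff, mem_singleton, mem_insert]; grind
    rw [hS, smul_smul, ← pow_succ', Finset.card_insert_of_notMem hj]
    set g : Fin d → R := fun i => if i ∈ insert j S then hR.im (Function.update z j y i)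
      else hR.re (Function.update z j y i) with hg
    have h1 : g = Function.update g j (hR.im y) := by
      rw [eq_comm, Function.update_eq_self_iff]; simp [hg]
    have h2 : (fun i => if i ∈ S then hR.im (Function.update z j (I • y) i)
        else hR.re (Function.update z j (I • y) i)) = Function.update g j (-hR.im y) := by
      ext1 i
      rcases eq_or_ne i j with rfl | hi
      · simp [hj, re_I_smul]
      · simp [hi, hg]
    rw [h2, M.map_update_neg, ← h1, pow_succ, pow_succ]
    simp [mul_assoc]

/-- The complexification of a real multilinear map on a real operator system. -/
def IsRealOperatorSystem.complexify (M : MultilinearMap ℝ (fun _ : Fin d => R) E) :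
    MultilinearMap ℂ (fun _ : Fin d => cspan R) E where
  toFun := hR.complexifyAux M
  map_update_add' := (hR.complexifyAux M).map_update_add'
  map_update_smul' := by
    intro inst z j c y
    have : inst = instDecidableEqFin d := Subsingleton.elim _ _
    subst this
    have hc : c • y = c.re • y + c.im • (I • y) := by
      conv_lhs => rw [← Complex.re_add_im c]
      rw [add_smul, mul_smul]
      rfl
    rw [hc, MultilinearMap.map_update_add, MultilinearMap.map_update_smul,
      MultilinearMap.map_update_smul, hR.complexifyAux_update_I_smul]
    conv_rhs => rw [← Complex.re_add_im c]
    rw [add_smul, mul_smul]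
    rfl

theorem IsRealOperatorSystem.complexify_apply (M : MultilinearMap ℝ (fun _ : Fin d => R) E)
    (z : Fin d → cspan R) : hR.complexify M z =
      ∑ S : Finset (Fin d), ((I : ℂ) ^ #S) •
        M (fun i => if i ∈ S then hR.im (z i) else hR.re (z i)) :=
  hR.complexifyAux_apply M z

theorem IsRealOperatorSystem.complexify_toCspan (M : MultilinearMap ℝ (fun _ : Fin d => R) E)
    (x : Fin d → R) : hR.complexify M (fun i => toCspan R (x i)) = M x := by
  rw [complexify_apply, Finset.sum_eq_single ∅]
  · simp [re_toCspan]
  · intro S _ hS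
    obtain ⟨i, hi⟩ := Finset.nonempty_iff_ne_empty.2 hS
    rw [M.map_coord_zero i (by simp [hi, im_toCspan]), smul_zero]
  · simp

theorem IsRealOperatorSystem.norm_complexify_le {M : MultilinearMap ℝ (fun _ : Fin d => R) E}
    {C : ℝ} (hC : 0 ≤ C) (hM : ∀ x, ‖M x‖ ≤ C * ∏ i, ‖x i‖) (z : Fin d → cspan R) :
    ‖hR.complexify M z‖ ≤ (2 ^ d * C) * ∏ i, ‖z i‖ := by
  rw [complexify_apply]
  have hterm (S : Finset (Fin d)) : ‖((I : ℂ) ^ #S) •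
      M (fun i => if i ∈ S then hR.im (z i) else hR.re (z i))‖ ≤ C * ∏ i, ‖z i‖ := by
    rw [norm_smul, norm_pow, norm_I, one_pow, one_mul]
    refine (hM _).trans ?_
    gcongr with i
    split_ifs
    · exact hR.norm_im_le _
    · exact hR.norm_re_le _
  refine (norm_sum_le_of_le _ fun S _ => hterm S).trans_eq ?_
  simp [mul_assoc]

theorem IsRealOperatorSystem.complexify_mem {M : MultilinearMap ℝ (fun _ : Fin d => R) E}
    {R₂ : Submodule ℝ E} (hM : ∀ x, M x ∈ R₂) (z : Fin d → cspan R) :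
    hR.complexify M z ∈ cspan R₂ := by
  rw [complexify_apply]
  exact (cspan R₂).sum_mem fun S _ => (cspan R₂).smul_mem _ (mem_cspan_of_mem (hM _))

include hR in
theorem IsRealOperatorSystem.multilinearMap_ext
    {N N' : MultilinearMap ℂ (fun _ : Fin d => cspan R) E}
    (h : ∀ x : Fin d → R, N (fun i => toCspan R (x i)) = N' (fun i => toCspan R (x i))) :
    N = N' := by
  ext z
  have hz : z = fun i => ∑ b : Fin 2, (![1, I] b : ℂ) • toCspan R (![hR.re (z i), hR.im (z i)] b) := by
    ext1 i
    simp [Fin.sum_univ_two, hR.toCspan_re_add]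
  rw [hz, N.map_sum, N'.map_sum]
  refine Finset.sum_congr rfl fun r _ => ?_
  rw [N.map_smul_univ (fun i => (![1, I] (r i) : ℂ)), N'.map_smul_univ (fun i => (![1, I] (r i) : ℂ)),
    h]

theorem toCspan_sum {E : Type*} [NormedAddCommGroup E] [NormedSpace ℂ E] {R : Submodule ℝ E}
    {ι : Type*} (s : Finset ι) (x : ι → R) :
    toCspan R (∑ i ∈ s, x i) = ∑ i ∈ s, toCspan R (x i) := by
  ext; simp [toCspan]

include hR in
-- With real directions, the polarization formula evaluates `H` only at real points, where it is
-- prescribed. A complex multilinear map is determined by its values on real vectors, and `H` is the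
-- diagonal of its polarization.
theorem IsRealOperatorSystem.complexification_unique {h : R → E} {H H' : cspan R → E}
    (hH : IsComplexification d h H) (hH' : IsComplexification d h H') : H = H' := by
  have key : polarization H hH.isGenHomPoly = polarization H' hH'.isGenHomPoly := by
    refine hR.multilinearMap_ext fun x => ?_
    simp only [polarization_apply, polarForm, ← toCspan_sum, hH.agree, hH'.agree]
  ext z
  rw [← polarization_diagonal hH.isGenHomPoly, key, polarization_diagonal]

end OperatorSystem

/-! ### Polarization estimates from positive contractions -/

section Bounds

variable {A : Type*} [CStarAlgebra A] [PartialOrder A] [StarOrderedRing A] {R : Submodule ℝ A}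

theorem half_smul_one_add_nonneg {y : A} (hy : IsSelfAdjoint y) (hn : ‖y‖ ≤ 1 / 2) :
    0 ≤ (1 / 2 : ℝ) • (1 : A) + y ∧ ‖(1 / 2 : ℝ) • (1 : A) + y‖ ≤ 1 := by
  have h1 := hy.neg_algebraMap_norm_le_self
  have h2 := hy.le_algebraMap_norm_self
  have h3 : algebraMap ℝ A ‖y‖ ≤ (1 / 2 : ℝ) • (1 : A) := by
    rw [← Algebra.algebraMap_eq_smul_one]
    exact algebraMap_mono A hn
  have h0 : 0 ≤ (1 / 2 : ℝ) • (1 : A) + y := by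
    rw [← neg_le_iff_add_nonneg']
    exact (neg_le_neg h3).trans h1
  refine ⟨h0, (CStarAlgebra.norm_le_one_iff_of_nonneg _ h0).2 ?_⟩
  calc (1 / 2 : ℝ) • (1 : A) + y ≤ (1 / 2 : ℝ) • (1 : A) + (1 / 2 : ℝ) • (1 : A) := by
        gcongr; exact h2.trans h3
    _ = 1 := by rw [← add_smul]; norm_num

variable {E : Type*} [NormedAddCommGroup E] [NormedSpace ℂ E] {d : ℕ}

/-- Based at `1/2 • 1`, each of the `2^d` sample points is displaced by at most `d · 1/(2d) = 1/2`,
hence is a positive contraction. -/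
theorem IsRealOperatorSystem.norm_polarForm_le (hR : IsRealOperatorSystem R) {h : R → E}
    (hh : IsGenHomPoly ℝ d h) (hb : ∀ x : R, 0 ≤ (x : A) → ‖x‖ ≤ 1 → ‖h x‖ ≤ 1)
    (x : Fin d → R) (hx : ∀ i, ‖x i‖ ≤ 1 / (2 * d)) : ‖polarForm h x‖ ≤ 2 ^ d := by
  rw [hh.polarForm_eq ((1 / 2 : ℝ) • ⟨1, hR.one_mem⟩) x]
  have hterm (S : Finset (Fin d)) : ‖((-1 : ℤ) ^ #S) •
      h ((1 / 2 : ℝ) • ⟨1, hR.one_mem⟩ + ∑ i ∈ Sᶜ, x i)‖ ≤ 1 := by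
    have hy : ‖∑ i ∈ Sᶜ, x i‖ ≤ 1 / 2 := by
      -- For `d = 0` the quotient `1/(2d)` is `0` by convention, but the sum is empty.
      rcases Nat.eq_zero_or_pos d with rfl | hd
      · simp [Finset.eq_empty_of_isEmpty]
      have hd' : (0 : ℝ) < d := by exact_mod_cast hd
      refine (norm_sum_le_of_le _ fun i _ => hx i).trans ?_
      rw [Finset.sum_const, nsmul_eq_mul]
      have : (#Sᶜ : ℝ) ≤ d := by exact_mod_cast (card_le_univ _).trans_eq (Fintype.card_fin d)
      calc (#Sᶜ : ℝ) * (1 / (2 * d)) ≤ d * (1 / (2 * d)) := by gcongr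
        _ = 1 / 2 := by field_simp
    obtain ⟨h0, h1⟩ := half_smul_one_add_nonneg (hR.isSelfAdjoint _ (∑ i ∈ Sᶜ, x i).2) hy
    have := hb ((1 / 2 : ℝ) • ⟨1, hR.one_mem⟩ + ∑ i ∈ Sᶜ, x i) h0 h1
    rcases neg_one_pow_eq_or ℤ #S with hs | hs <;> simpa [hs] using this
  refine (norm_sum_le_of_le _ fun S _ => hterm S).trans_eq ?_
  simp

/-- Rescaling the directions to norm `1/(2d)` gives the constant `(2d)^d · 2^d / d!`, which is at
most `(4e)^d`. -/
theorem IsRealOperatorSystem.norm_polarization_le (hR : IsRealOperatorSystem R) {h : R → E}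
    (hh : IsGenHomPoly ℝ d h) (hb : ∀ x : R, 0 ≤ (x : A) → ‖x‖ ≤ 1 → ‖h x‖ ≤ 1)
    (x : Fin d → R) : ‖polarization h hh x‖ ≤ (4 * Real.exp 1) ^ d * ∏ i, ‖x i‖ := by
  by_cases hx : ∃ i, x i = 0
  · obtain ⟨i, hi⟩ := hx
    rw [(polarization h hh).map_coord_zero i hi, norm_zero]
    positivity
  push Not at hx
  let c : Fin d → ℝ := fun i => 2 * d * ‖x i‖
  have hc (i : Fin d) : 0 < c i := by
    have : (0 : ℝ) < d := by exact_mod_cast i.pos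
    have := norm_pos_iff.2 (hx i)
    positivity
  have hxy : x = fun i => c i • ((c i)⁻¹ • x i) := by
    ext1 i; rw [smul_inv_smul₀ (hc i).ne']
  have hy (i : Fin d) : ‖(c i)⁻¹ • x i‖ ≤ 1 / (2 * d) := by
    have hn := norm_pos_iff.2 (hx i)
    rw [norm_smul, norm_inv, Real.norm_of_nonneg (hc i).le]
    apply le_of_eq
    simp only [c]
    field_simp
  have hpf := hR.norm_polarForm_le hh hb (fun i => (c i)⁻¹ • x i) hy
  conv_lhs => rw [hxy]
  rw [(polarization h hh).map_smul_univ, polarization_apply, norm_smul, norm_smul, norm_inv,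
    Real.norm_natCast, Real.norm_of_nonneg (prod_nonneg fun i _ => (hc i).le)]
  have hfac : (d : ℝ) ^ d / d.factorial ≤ Real.exp 1 ^ d := by
    rw [← Real.exp_nat_mul, mul_one]
    exact Real.pow_div_factorial_le_exp d (Nat.cast_nonneg d) d
  calc (∏ i, c i) * ((d.factorial : ℝ)⁻¹ * ‖polarForm h fun i => (c i)⁻¹ • x i‖)
      ≤ (∏ i, c i) * ((d.factorial : ℝ)⁻¹ * 2 ^ d) := by
        gcongr
    _ = 4 ^ d * ((d : ℝ) ^ d / d.factorial) * ∏ i, ‖x i‖ := by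
        simp only [c, prod_mul_distrib, prod_const, card_univ, Fintype.card_fin]
        rw [show (4 : ℝ) = 2 * 2 by norm_num, mul_pow]
        ring
    _ ≤ 4 ^ d * Real.exp 1 ^ d * ∏ i, ‖x i‖ := by gcongr
    _ = (4 * Real.exp 1) ^ d * ∏ i, ‖x i‖ := by rw [mul_pow]

/-- A generalized homogeneous polynomial of degree `d` that is bounded by `1` on the positive
contractions of a real operator system extends to the complexification, as the diagonal of a
continuous multilinear map whose norm is at most exponential in `d`. -/
theorem IsRealOperatorSystem.exists_continuousMultilinearMap (hR : IsRealOperatorSystem R)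
    {h : R → E} (hh : IsGenHomPoly ℝ d h)
    (hb : ∀ x : R, 0 ≤ (x : A) → ‖x‖ ≤ 1 → ‖h x‖ ≤ 1) :
    ∃ M : ContinuousMultilinearMap ℂ (fun _ : Fin d => cspan R) E,
      ‖M‖ ≤ (8 * Real.exp 1) ^ d ∧ IsComplexification d h (fun z => M fun _ => z) ∧
      ∀ R₂ : Submodule ℝ E, (∀ x, h x ∈ R₂) → ∀ z, M z ∈ cspan R₂ := by
  have hbound := hR.norm_complexify_le (by positivity) (hR.norm_polarization_le hh hb)
  have hconst : 2 ^ d * (4 * Real.exp 1) ^ d = (8 * Real.exp 1) ^ d := by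
    rw [← mul_pow]; ring
  rw [hconst] at hbound
  refine ⟨(hR.complexify (polarization h hh)).mkContinuous _ hbound,
    MultilinearMap.mkContinuous_norm_le _ (by positivity) _, ⟨isGenHomPoly_diagonal _, fun x => ?_⟩,
    fun R₂ hR₂ z => hR.complexify_mem (fun x => ?_) z⟩
  · exact (hR.complexify_toCspan _ fun _ => x).trans (polarization_diagonal hh x)
  · rw [polarization_apply]
    exact R₂.smul_mem _ (R₂.sum_mem fun S _ => zsmul_mem (hR₂ _) _)

end Bounds

/-! ### Power series with geometrically bounded coefficients -/

section Series

theorem tsum_mem_of_isClosed {𝕜 E ι : Type*} [Semiring 𝕜] [AddCommMonoid E]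
    [TopologicalSpace E] [Module 𝕜 E] {S : Submodule 𝕜 E} (hS : IsClosed (S : Set E)) {f : ι → E}
    (hf : Summable f) (hmem : ∀ i, f i ∈ S) : ∑' i, f i ∈ S :=
  hS.mem_of_tendsto hf.hasSum (.of_forall fun _ => S.sum_mem fun i _ => hmem i)

variable {E : Type*} [NormedAddCommGroup E] {f : ℕ → E}

theorem norm_tsum_le_two (hf : ∀ d, ‖f d‖ ≤ (1 / 2) ^ d) : ‖∑' d, f d‖ ≤ 2 :=
  tsum_of_norm_bounded hasSum_geometric_two hf

theorem summable_norm_of_le_half_pow (hf : ∀ d, ‖f d‖ ≤ (1 / 2) ^ d) :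
    Summable fun d => ‖f d‖ :=
  summable_geometric_two.of_nonneg_of_le (fun _ => norm_nonneg _) hf

theorem norm_tsum_sub_sum_range_le [CompleteSpace E] (hf : ∀ d, ‖f d‖ ≤ (1 / 2) ^ d) (N : ℕ) :
    ‖(∑' d, f d) - ∑ d ∈ range N, f d‖ ≤ 2 * (1 / 2) ^ N := by
  rw [norm_sub_rev]
  have := norm_sub_le_of_geometric_bound_of_hasSum (r := 1 / 2) (C := 1) (by norm_num)
    (by simpa using hf) (summable_norm_of_le_half_pow hf).of_norm.hasSum N
  refine this.trans_eq ?_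
  ring

end Series

section PowerSeries

variable {V E : Type*} [NormedAddCommGroup V] [NormedSpace ℂ V] [NormedAddCommGroup E]
  [NormedSpace ℂ E] {p : FormalMultilinearSeries ℂ V E} {K : ℝ}

theorem norm_diagonal_le_geometric (hK : 0 < K) (hp : ∀ d, ‖p d‖ ≤ K ^ d) {z : V}
    (hz : ‖z‖ < (2 * K)⁻¹) (d : ℕ) : ‖p d fun _ => z‖ ≤ (1 / 2) ^ d := by
  calc ‖p d fun _ => z‖ ≤ ‖p d‖ * ∏ _i : Fin d, ‖z‖ := (p d).le_opNorm _
    _ ≤ K ^ d * ((2 * K)⁻¹) ^ d := by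
        rw [prod_const, card_univ, Fintype.card_fin]
        gcongr
        exact hp d
    _ = (1 / 2) ^ d := by
        rw [← mul_pow]
        congr 1
        field_simp

theorem analyticOnNhd_tsum_diagonal [CompleteSpace E] (hK : 0 < K) (hp : ∀ d, ‖p d‖ ≤ K ^ d) :
    AnalyticOnNhd ℂ (fun z => ∑' d, p d fun _ => z) (Metric.ball 0 (2 * K)⁻¹) := by
  let r : NNReal := ⟨(2 * K)⁻¹, by positivity⟩
  have hr : (r : ENNReal) ≤ p.radius := by
    refine p.le_radius_of_bound 1 fun d => ?_
    calc ‖p d‖ * (r : ℝ) ^ d ≤ K ^ d * ((2 * K)⁻¹) ^ d := by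
          gcongr
          · exact hp d
          · exact le_rfl
      _ = (1 / 2) ^ d := by
          rw [← mul_pow]
          congr 1
          field_simp
      _ ≤ 1 := pow_le_one₀ (by norm_num) (by norm_num)
  have hr0 : (0 : ENNReal) < r := by
    rw [ENNReal.coe_pos]
    exact NNReal.coe_pos.1 (inv_pos.2 (by positivity))
  refine (p.hasFPowerSeriesOnBall (hr0.trans_le hr)).analyticOnNhd.mono fun z hz => ?_
  refine Metric.eball_subset_eball hr ?_
  rw [Metric.eball_coe]
  exact hz

end PowerSeries

/-! ### The Hermitian part of a level of the matrix universe -/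

section Level

variable {A B : Type*} [CStarAlgebra A] [CStarAlgebra B]

/-- The self-adjoint elements of the level `n` of the matrix universe over `R`. -/
def hermPart (R : Submodule ℝ A) (n : ℕ) : Submodule ℝ (CStarMatrix (Fin n) (Fin n) A) where
  carrier := {X | X ∈ matUniv R n ∧ IsSelfAdjoint X}
  add_mem' := fun hX hY => ⟨(matUniv R n).add_mem hX.1 hY.1, hX.2.add hY.2⟩
  zero_mem' := ⟨(matUniv R n).zero_mem, .zero _⟩
  smul_mem' := fun c _ hX => ⟨fun i j => (cspan R).smul_of_tower_mem c (hX.1 i j),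
    (IsSelfAdjoint.all c).smul hX.2⟩

theorem mem_hermPart {R : Submodule ℝ A} {n : ℕ} {X : CStarMatrix (Fin n) (Fin n) A} :
    X ∈ hermPart R n ↔ X ∈ matUniv R n ∧ IsSelfAdjoint X := Iff.rfl

variable {R : Submodule ℝ A} {n : ℕ}

theorem IsRealOperatorSystem.star_mem_cspan (hR : IsRealOperatorSystem R) {z : A}
    (hz : z ∈ cspan R) : star z ∈ cspan R := by
  induction hz using Submodule.span_induction with
  | mem x hx => exact (hR.isSelfAdjoint x hx).star_eq.symm ▸ mem_cspan_of_mem hx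
  | zero => simp
  | add x y _ _ hx hy => exact star_add x y ▸ (cspan R).add_mem hx hy
  | smul c x _ hx => exact star_smul c x ▸ (cspan R).smul_mem _ hx

theorem IsRealOperatorSystem.star_mem_matUniv (hR : IsRealOperatorSystem R)
    {X : CStarMatrix (Fin n) (Fin n) A} (hX : X ∈ matUniv R n) : star X ∈ matUniv R n :=
  fun i j => hR.star_mem_cspan (hX j i)

theorem tens_smul (c : ℂ) (T : Matrix (Fin n) (Fin n) ℂ) (a : A) :
    tens (c • T) a = c • tens T a := by
  ext i j
  simp [tens, CStarMatrix.smul_apply, mul_smul]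

theorem smul_list_ofFn_prod {d : ℕ} (c : Fin d → ℂ) (T : Fin d → Matrix (Fin n) (Fin n) ℂ) :
    (List.ofFn fun j => c j • T j).prod = (∏ j, c j) • (List.ofFn T).prod := by
  induction d with
  | zero => simp
  | succ d ih =>
    rw [List.ofFn_succ, List.ofFn_succ, List.prod_cons, List.prod_cons, Fin.prod_univ_succ, ih,
      smul_mul_smul_comm]

theorem IsRealOperatorSystem.isClosed_cspan (hR : IsRealOperatorSystem R)
    (hc : IsClosed (R : Set A)) : IsClosed (cspan R : Set A) := by
  have hre : Continuous fun z : A => (ℜ z : A) := by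
    simp only [realPart_apply_coe]; fun_prop
  have him : Continuous fun z : A => (ℑ z : A) := by
    simp only [imaginaryPart_apply_coe]; fun_prop
  have : (cspan R : Set A) = {z | (ℜ z : A) ∈ R} ∩ {z | (ℑ z : A) ∈ R} := by
    ext z; exact hR.mem_cspan_iff
  rw [this]
  exact (hc.preimage hre).inter (hc.preimage him)

theorem IsRealOperatorSystem.topologicalClosure (hR : IsRealOperatorSystem R) :
    IsRealOperatorSystem R.topologicalClosure where
  one_mem := R.le_topologicalClosure hR.one_mem
  isSelfAdjoint x hx := by
    have : IsClosed {x : A | star x = x} := isClosed_eq continuous_star continuous_id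
    exact closure_minimal (fun y hy => hR.isSelfAdjoint y hy) this hx

theorem cspan_mono {E : Type*} [NormedAddCommGroup E] [NormedSpace ℂ E] {R S : Submodule ℝ E}
    (h : R ≤ S) : cspan R ≤ cspan S :=
  Submodule.span_mono h

section Topology

variable [PartialOrder A] [StarOrderedRing A]

theorem IsRealOperatorSystem.hermPart (hR : IsRealOperatorSystem R) :
    IsRealOperatorSystem (hermPart R n) where
  one_mem := by
    refine ⟨fun i j => ?_, .one _⟩
    rw [CStarMatrix.one_apply]
    split_ifs
    · exact mem_cspan_of_mem hR.one_mem
    · exact (cspan R).zero_mem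
  isSelfAdjoint _ hX := hX.2

/-- A level is closed under adjoints, so it contains the real and imaginary parts of its elements.
This reduces the noncommutative estimates to the scalar-level ones over `M_n(A)`. -/
theorem IsRealOperatorSystem.cspan_hermPart (hR : IsRealOperatorSystem R) :
    cspan (WedgeOfEdge.hermPart R n) = matUniv R n := by
  refine le_antisymm (Submodule.span_le.2 fun X hX => hX.1) fun X hX => ?_
  rw [hR.hermPart.mem_cspan_iff]
  have hs := hR.star_mem_matUniv hX
  refine ⟨⟨?_, (ℜ X).2⟩, ⟨?_, (ℑ X).2⟩⟩
  · rw [realPart_apply_coe]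
    exact (matUniv R n).smul_of_tower_mem _ ((matUniv R n).add_mem hX hs)
  · rw [imaginaryPart_apply_coe]
    exact (matUniv R n).smul_mem _
      ((matUniv R n).smul_of_tower_mem _ ((matUniv R n).sub_mem hX hs))

/-- The matrix entry as a continuous linear map. -/
def entryCLM (i j : Fin n) : CStarMatrix (Fin n) (Fin n) A →L[ℂ] A :=
  LinearMap.mkContinuous
    { toFun := fun X => X i j, map_add' := fun _ _ => rfl, map_smul' := fun _ _ => rfl } 1
    fun X => (one_mul ‖X‖).symm ▸ CStarMatrix.norm_entry_le_norm (M := X) (i := i) (j := j)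

theorem entryCLM_apply (i j : Fin n) (X : CStarMatrix (Fin n) (Fin n) A) :
    entryCLM i j X = X i j := rfl

theorem tsum_entry {ι : Type*} {f : ι → CStarMatrix (Fin n) (Fin n) A} (hf : Summable f)
    (i j : Fin n) : (∑' a, f a) i j = ∑' a, f a i j := by
  simpa only [entryCLM_apply] using (entryCLM (A := A) i j).map_tsum hf

theorem sum_entry {ι : Type*} (s : Finset ι) (f : ι → CStarMatrix (Fin n) (Fin n) A)
    (i j : Fin n) : (∑ a ∈ s, f a) i j = ∑ a ∈ s, f a i j := by
  simpa only [entryCLM_apply] using map_sum (entryCLM (A := A) i j) f s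

theorem IsRealOperatorSystem.exists_eq_sum_tens (hR : IsRealOperatorSystem R)
    {Z : CStarMatrix (Fin n) (Fin n) A} (hZ : Z ∈ matUniv R n) :
    ∃ (T : Fin n × Fin n × Fin 2 → Matrix (Fin n) (Fin n) ℂ) (x : Fin n × Fin n × Fin 2 → A),
      (∀ q, x q ∈ R) ∧ Z = ∑ q, tens (T q) (x q) := by
  -- The entry at `(a, b)` contributes its real part with the matrix unit and its imaginary part
  -- with `I` times it, so that all vectors lie in `R`.
  refine ⟨fun q => Matrix.single q.1 q.2.1 (![1, I] q.2.2),
    fun q => ![(ℜ (Z q.1 q.2.1) : A), (ℑ (Z q.1 q.2.1) : A)] q.2.2, ?_, ?_⟩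
  · rintro ⟨a, b, s⟩
    have := hR.mem_cspan_iff.1 (hZ a b)
    fin_cases s
    exacts [this.1, this.2]
  · ext i j
    rw [sum_entry]
    simp only [Fintype.sum_prod_type, Fin.sum_univ_two, tens, CStarMatrix.ofMatrix_apply,
      Matrix.map_apply, Matrix.single_apply, ite_smul, zero_smul]
    rw [Finset.sum_eq_single i, Finset.sum_eq_single j]
    · simp [realPart_add_I_smul_imaginaryPart]
    · intro b _ hb; simp [hb]
    · simp
    · intro a _ ha; simp [ha]
    · simp

/-- Each level of a noncommutative generalized homogeneous polynomial is a complex generalized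
homogeneous polynomial. -/
theorem IsNCGenHomPoly.isGenHomPoly (hR : IsRealOperatorSystem R) {R₂ : Submodule ℝ B} {d : ℕ}
    {h : ∀ n : ℕ, CStarMatrix (Fin n) (Fin n) A → CStarMatrix (Fin n) (Fin n) B}
    (hh : IsNCGenHomPoly R R₂ d h) (n : ℕ) :
    IsGenHomPoly ℂ d (fun Z : matUniv R n => h n Z) := by
  intro k Z
  choose T x hx hZ using fun i => hR.exists_eq_sum_tens (Z i).2
  let κ := Fin k × Fin n × Fin n × Fin 2
  let e := Fintype.equivFin κ
  -- All the `Z i` are expanded over one family of vectors in `R`. The scalars `t i` are absorbed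
  -- into the matrices, then pulled out of each word; a letter only has to remember which `Z i` it
  -- came from.
  obtain ⟨C, -, hC⟩ := hh.poly (Fintype.card κ)
    (fun q => x (e.symm q).1 (e.symm q).2) (fun q => hx _ _)
  obtain ⟨c, hc⟩ := exists_coeff_of_sum_words (𝕜 := ℂ)
    (fun (w : Fin d → Fin (Fintype.card κ)) j => (e.symm (w j)).1)
    (fun w => tens (List.ofFn fun j => T (e.symm (w j)).1 (e.symm (w j)).2).prod (C w) :
      _ → CStarMatrix (Fin n) (Fin n) B)
  refine ⟨c, fun t => ?_⟩
  have hsum : ((∑ i, t i • Z i : matUniv R n) : CStarMatrix (Fin n) (Fin n) A) =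
      ∑ q, tens (t (e.symm q).1 • T (e.symm q).1 (e.symm q).2) (x (e.symm q).1 (e.symm q).2) := by
    rw [Equiv.sum_comp e.symm fun q : κ => tens (t q.1 • T q.1 q.2) (x q.1 q.2),
      Fintype.sum_prod_type]
    simp only [Submodule.coe_sum, Submodule.coe_smul, tens_smul, ← Finset.smul_sum, ← hZ]
  dsimp only
  rw [hsum, hC, ← hc]
  refine Finset.sum_congr rfl fun w _ => ?_
  rw [← tens_smul, ← smul_list_ofFn_prod]

theorem tsum_dsum {m : ℕ} {ι : Type*} {f : ι → CStarMatrix (Fin m) (Fin m) A}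
    {g : ι → CStarMatrix (Fin n) (Fin n) A} (hf : Summable f) (hg : Summable g)
    (hfg : Summable fun a => dsum (f a) (g a)) :
    ∑' a, dsum (f a) (g a) = dsum (∑' a, f a) (∑' a, g a) := by
  ext i j
  rw [tsum_entry hfg]
  refine Fin.addCases (fun i => ?_) (fun i => ?_) i <;>
    refine Fin.addCases (fun j => ?_) (fun j => ?_) j <;>
    simp [dsum, tsum_entry hf, tsum_entry hg]

theorem tsum_conj {ι : Type*} {f : ι → CStarMatrix (Fin n) (Fin n) A} (hf : Summable f)
    (S : GL (Fin n) ℂ) : ∑' a, conj S (f a) = conj S (∑' a, f a) := by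
  simp only [conj]
  rw [(hf.mul_left _).tsum_mul_right, hf.tsum_mul_left]

end Topology

end Level

/-! ### The power series of the complexified polynomials -/

section Commutative

theorem norm_le_one_of_tsum_norm_le_one {E : Type*} [NormedAddCommGroup E] {f : ℕ → E}
    (hs : Summable fun d => ‖f d‖)
    (h1 : ∑' d, ‖f d‖ ≤ 1) (d : ℕ) : ‖f d‖ ≤ 1 :=
  (hs.le_tsum d fun _ _ => norm_nonneg _).trans h1

variable {A E : Type*} [CStarAlgebra A] [PartialOrder A] [StarOrderedRing A]
  [NormedAddCommGroup E] [NormedSpace ℂ E] {R : Submodule ℝ A}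

/-- The complexifications of a sequence of generalized homogeneous polynomials that are bounded by
`1` on the positive contractions are the terms of a power series with geometrically bounded
coefficients. -/
theorem IsRealOperatorSystem.exists_formalMultilinearSeries (hR : IsRealOperatorSystem R)
    {h : ℕ → R → E} (hh : ∀ d, IsGenHomPoly ℝ d (h d))
    (hb : ∀ x : R, 0 ≤ (x : A) → ‖x‖ ≤ 1 → ∀ d, ‖h d x‖ ≤ 1)
    {H : ℕ → cspan R → E} (hH : ∀ d, IsComplexification d (h d) (H d)) :
    ∃ p : FormalMultilinearSeries ℂ (cspan R) E, (∀ d, ‖p d‖ ≤ (8 * Real.exp 1) ^ d) ∧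
      (∀ d, H d = fun z => p d fun _ => z) ∧
      ∀ R₂ : Submodule ℝ E, (∀ d x, h d x ∈ R₂) → ∀ d z, H d z ∈ cspan R₂ := by
  choose M hM hMh hMR using fun d => hR.exists_continuousMultilinearMap (hh d)
    (fun x h0 h1 => hb x h0 h1 d)
  have heq (d : ℕ) : H d = fun z => M d fun _ => z := hR.complexification_unique (hH d) (hMh d)
  refine ⟨M, hM, heq, fun R₂ hR₂ d z => ?_⟩
  rw [heq]
  exact hMR d R₂ (hR₂ d) _

end Commutative

/-! ### Sums of free polynomials, uniformly in the matrix size -/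

section Noncommutative

/-- The pointwise sum of a series of free functions is free, with values over the closure. -/
theorem isFreeFunction_tsum {A B : Type*} [CStarAlgebra A] [CStarAlgebra B] [PartialOrder B]
    [StarOrderedRing B] {R₁ : Submodule ℝ A} {R₂ : Submodule ℝ B} (hR₂ : IsRealOperatorSystem R₂)
    {h : ℕ → ∀ n : ℕ, CStarMatrix (Fin n) (Fin n) A → CStarMatrix (Fin n) (Fin n) B}
    (hh : ∀ d, IsFreeFunction R₁ R₂ (fun n => (matUniv R₁ n : Set _)) (h d))
    {G : ∀ n : ℕ, Set (CStarMatrix (Fin n) (Fin n) A)} (hG : ∀ n, ∀ X ∈ G n, X ∈ matUniv R₁ n)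
    (hs : ∀ n, ∀ X ∈ G n, Summable fun d => h d n X) :
    IsFreeFunction R₁ R₂.topologicalClosure G (fun n Z => ∑' d, h d n Z) where
  domain_subset := hG
  maps_to n X hX i j := by
    rw [tsum_entry (hs n X hX)]
    -- Entries of the sum stay over the closure of `R₂`: that closure is again a real operator
    -- system, and its complexification is closed because real and imaginary parts are continuous.
    refine tsum_mem_of_isClosed
      (hR₂.topologicalClosure.isClosed_cspan R₂.isClosed_topologicalClosure)
      ((entryCLM i j).summable (hs n X hX)) fun d => ?_
    exact cspan_mono R₂.le_topologicalClosure ((hh d).maps_to n X (hG n X hX) i j)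
  map_dsum m n X hX Y hY hXY := by
    have hd (d : ℕ) : h d (m + n) (dsum X Y) = dsum (h d m X) (h d n Y) :=
      (hh d).map_dsum m n X (hG m X hX) Y (hG n Y hY) (hG _ _ hXY)
    have hXYs := hs _ _ hXY
    simp only [hd] at hXYs ⊢
    exact tsum_dsum (hs m X hX) (hs n Y hY) hXYs
  map_conj n X hX S hS := by
    have hd (d : ℕ) : h d n (conj S X) = conj S (h d n X) :=
      (hh d).map_conj n X (hG n X hX) S (hG _ _ hS)
    simp only [hd]
    exact tsum_conj (hs n X hX) S

/-- The restriction to `R` of a complex generalized homogeneous polynomial on `R + iR` is a real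
generalized homogeneous polynomial. -/
theorem IsGenHomPoly.restrict {A E : Type*} [NormedAddCommGroup A] [NormedSpace ℂ A]
    [NormedAddCommGroup E] [NormedSpace ℂ E] {d : ℕ} {R : Submodule ℝ A} {H : cspan R → E}
    (hH : IsGenHomPoly ℂ d H) :
    IsGenHomPoly ℝ d (fun x : R => H (toCspan R x)) := by
  intro k x
  obtain ⟨c, hc⟩ := hH k fun i => toCspan R (x i)
  refine ⟨c, fun t => ?_⟩
  have h1 : toCspan R (∑ i, t i • x i) = ∑ i, (t i : ℂ) • toCspan R (x i) := by
    rw [toCspan_sum]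
    rfl
  dsimp only
  rw [h1, hc]
  refine Finset.sum_congr rfl fun α _ => ?_
  rw [← Complex.coe_smul]
  push_cast
  rfl

variable {A B : Type*} [CStarAlgebra A] [PartialOrder A] [StarOrderedRing A]
  [CStarAlgebra B] [PartialOrder B] [StarOrderedRing B]
  {R₁ : Submodule ℝ A} {R₂ : Submodule ℝ B}

/-- Each level of a sequence of noncommutative generalized homogeneous polynomials is a power
series with geometrically bounded coefficients, uniformly in the level. -/
theorem exists_formalMultilinearSeries_level (hR₁ : IsRealOperatorSystem R₁)
    {h : ℕ → ∀ n : ℕ, CStarMatrix (Fin n) (Fin n) A → CStarMatrix (Fin n) (Fin n) B}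
    (hh : ∀ d, IsNCGenHomPoly R₁ R₂ d (h d)) {n : ℕ}
    (hb : ∀ X ∈ ncPosContractions R₁ n, ∀ d, ‖h d n X‖ ≤ 1) :
    ∃ p : FormalMultilinearSeries ℂ (matUniv R₁ n) (CStarMatrix (Fin n) (Fin n) B),
      (∀ d, ‖p d‖ ≤ (8 * Real.exp 1) ^ d) ∧
      ∀ d (Z : matUniv R₁ n), h d n Z = p d fun _ => Z := by
  have hpoly (d : ℕ) := (hh d).isGenHomPoly hR₁ n
  have hmem (X : hermPart R₁ n) := (mem_hermPart.1 X.2).1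
  -- The level is replaced by the complexification of its Hermitian part, in the goal and in `hpoly`
  -- alike. Each polynomial is then by definition a complexification of its own restriction.
  revert hpoly
  rw [← hR₁.cspan_hermPart]
  intro hpoly
  obtain ⟨p, hp, hpH, -⟩ := hR₁.hermPart.exists_formalMultilinearSeries
    (fun d => (hpoly d).restrict) (fun X h0 h1 d => hb X ⟨hmem X, h0, h1⟩ d)
    (fun d => ⟨hpoly d, fun _ => rfl⟩)
  exact ⟨p, hp, fun d Z => congrFun (hpH d) Z⟩

theorem norm_level_le_half_pow (hR₁ : IsRealOperatorSystem R₁)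
    {h : ℕ → ∀ n : ℕ, CStarMatrix (Fin n) (Fin n) A → CStarMatrix (Fin n) (Fin n) B}
    (hh : ∀ d, IsNCGenHomPoly R₁ R₂ d (h d)) {n : ℕ}
    (hb : ∀ X ∈ ncPosContractions R₁ n, ∀ d, ‖h d n X‖ ≤ 1)
    {Z : CStarMatrix (Fin n) (Fin n) A} (hZ : Z ∈ ncBall R₁ (2 * (8 * Real.exp 1))⁻¹ n) (d : ℕ) :
    ‖h d n Z‖ ≤ (1 / 2) ^ d := by
  obtain ⟨p, hp, hph⟩ := exists_formalMultilinearSeries_level hR₁ hh hb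
  obtain ⟨hZ, hδ⟩ := hZ
  lift Z to matUniv R₁ n using hZ
  rw [hph]
  exact norm_diagonal_le_geometric (by positivity) hp hδ d

theorem analyticOnNhd_tsum_level (hR₁ : IsRealOperatorSystem R₁)
    {h : ℕ → ∀ n : ℕ, CStarMatrix (Fin n) (Fin n) A → CStarMatrix (Fin n) (Fin n) B}
    (hh : ∀ d, IsNCGenHomPoly R₁ R₂ d (h d)) {n : ℕ}
    (hb : ∀ X ∈ ncPosContractions R₁ n, ∀ d, ‖h d n X‖ ≤ 1) :
    AnalyticOnNhd ℂ (fun Z : matUniv R₁ n => ∑' d, h d n Z)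
      {Z | (Z : CStarMatrix (Fin n) (Fin n) A) ∈ ncBall R₁ (2 * (8 * Real.exp 1))⁻¹ n} := by
  obtain ⟨p, hp, hph⟩ := exists_formalMultilinearSeries_level hR₁ hh hb
  simp only [hph]
  exact (analyticOnNhd_tsum_diagonal (by positivity) hp).mono fun Z hZ =>
    mem_ball_zero_iff.2 hZ.2

end Noncommutative

end WedgeOfEdge
end

/-! ### Choice of the constants and conclusion -/

open WedgeOfEdge in
theorem mainTheorem9 :
    ∃ δ ε : ℝ, 0 < δ ∧ 0 < ε ∧
      -- the commutative case
      (∀ (A : Type*) [CStarAlgebra A] [PartialOrder A] [StarOrderedRing A]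
        (E : Type*) [NormedAddCommGroup E] [NormedSpace ℂ E] [CompleteSpace E]
        (R₁ : Submodule ℝ A) (R₂ : Submodule ℝ E), IsRealOperatorSystem R₁ →
        ∀ h : ℕ → R₁ → E,
          (∀ d, IsGenHomPoly ℝ d (h d)) → (∀ d x, h d x ∈ R₂) →
          (∀ x : R₁, 0 ≤ (x : A) → ‖x‖ ≤ 1 →
            Summable (fun d => ‖h d x‖) ∧ ∑' d, ‖h d x‖ ≤ 1) →
          (∀ d, ∃! H : cspan R₁ → E, IsComplexification d (h d) H) ∧
          ∀ H : ℕ → cspan R₁ → E, (∀ d, IsComplexification d (h d) (H d)) →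
            (∀ Z ∈ Metric.ball (0 : cspan R₁) δ, Summable fun d => ‖H d Z‖) ∧
            TendstoUniformlyOn (fun N Z => ∑ d ∈ Finset.range N, H d Z) (fun Z => ∑' d, H d Z)
              Filter.atTop (Metric.ball (0 : cspan R₁) δ) ∧
            AnalyticOnNhd ℂ (fun Z => ∑' d, H d Z) (Metric.ball (0 : cspan R₁) δ) ∧
            ∀ Z ∈ Metric.ball (0 : cspan R₁) δ,
              ∑' d, H d Z ∈ (cspan R₂).topologicalClosure ∧ ‖∑' d, H d Z‖ ≤ ε) ∧
      -- the noncommutative case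
      (∀ (A : Type*) [CStarAlgebra A] [PartialOrder A] [StarOrderedRing A]
        (B : Type*) [CStarAlgebra B] [PartialOrder B] [StarOrderedRing B]
        (R₁ : Submodule ℝ A) (R₂ : Submodule ℝ B),
        IsRealOperatorSystem R₁ → IsRealOperatorSystem R₂ →
        ∀ h : ℕ → ∀ n : ℕ, CStarMatrix (Fin n) (Fin n) A → CStarMatrix (Fin n) (Fin n) B,
          (∀ d, IsNCGenHomPoly R₁ R₂ d (h d)) →
          (∀ n, ∀ X ∈ ncPosContractions R₁ n,
            Summable (fun d => ‖h d n X‖) ∧ ∑' d, ‖h d n X‖ ≤ 1) →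
          (∀ n, ∀ Z ∈ ncBall R₁ δ n, Summable fun d => ‖h d n Z‖) ∧
          (∀ η : ℝ, 0 < η → ∃ N₀ : ℕ, ∀ N ≥ N₀, ∀ n, ∀ Z ∈ ncBall R₁ δ n,
            ‖(∑' d, h d n Z) - ∑ d ∈ Finset.range N, h d n Z‖ < η) ∧
          IsNCAnalytic R₁ R₂.topologicalClosure (ncBall R₁ δ) (fun n Z => ∑' d, h d n Z) ∧
          ∀ n, ∀ Z ∈ ncBall R₁ δ n, ‖∑' d, h d n Z‖ ≤ ε) := by
  have hK : 0 < 8 * Real.exp 1 := by positivity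
  -- With coefficients bounded by `K^d`, `K = 8e`, the radius `1/(2K)` makes the degree `d` term at
  -- most `2^{-d}`; the bound `2` is the sum of this geometric series.
  refine ⟨(2 * (8 * Real.exp 1))⁻¹, 2, by positivity, two_pos, ?_, ?_⟩
  · intro A _ _ _ E _ _ _ R₁ R₂ hR₁ h hh hhR₂ hsum
    have hb (x : R₁) (h0 : 0 ≤ (x : A)) (h1 : ‖x‖ ≤ 1) : ∀ d, ‖h d x‖ ≤ 1 :=
      norm_le_one_of_tsum_norm_le_one (hsum x h0 h1).1 (hsum x h0 h1).2
    refine ⟨fun d => ?_, fun H hH => ?_⟩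
    · obtain ⟨M, -, hM, -⟩ :=
        hR₁.exists_continuousMultilinearMap (hh d) fun x h0 h1 => hb x h0 h1 d
      exact ⟨_, hM, fun H' hH' => hR₁.complexification_unique hH' hM⟩
    · obtain ⟨p, hp, hpH, hmem⟩ := hR₁.exists_formalMultilinearSeries hh hb hH
      have hgeo : ∀ d, ∀ Z ∈ Metric.ball (0 : cspan R₁) (2 * (8 * Real.exp 1))⁻¹,
          ‖H d Z‖ ≤ (1 / 2) ^ d := fun d Z hZ => by
        rw [hpH]
        exact norm_diagonal_le_geometric hK hp (mem_ball_zero_iff.1 hZ) d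
      refine ⟨fun Z hZ => summable_norm_of_le_half_pow fun d => hgeo d Z hZ,
        tendstoUniformlyOn_tsum_nat summable_geometric_two hgeo, ?_, fun Z hZ => ⟨?_, ?_⟩⟩
      · simp only [hpH]
        exact analyticOnNhd_tsum_diagonal hK hp
      · exact tsum_mem_of_isClosed (cspan R₂).isClosed_topologicalClosure
          (summable_norm_of_le_half_pow fun d => hgeo d Z hZ).of_norm
          fun d => (cspan R₂).le_topologicalClosure (hmem R₂ hhR₂ d Z)
      · exact norm_tsum_le_two fun d => hgeo d Z hZ
  · intro A _ _ _ B _ _ _ R₁ R₂ hR₁ hR₂ h hh hsum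
    have hb (n : ℕ) (X) (hX : X ∈ ncPosContractions R₁ n) : ∀ d, ‖h d n X‖ ≤ 1 :=
      norm_le_one_of_tsum_norm_le_one (hsum n X hX).1 (hsum n X hX).2
    have hgeo (n : ℕ) (Z) (hZ : Z ∈ ncBall R₁ (2 * (8 * Real.exp 1))⁻¹ n) :
        ∀ d, ‖h d n Z‖ ≤ (1 / 2) ^ d := norm_level_le_half_pow hR₁ hh (hb n) hZ
    refine ⟨fun n Z hZ => summable_norm_of_le_half_pow (hgeo n Z hZ), fun η hη => ?_,
      ⟨isFreeFunction_tsum hR₂ (fun d => (hh d).free) (fun n Z hZ => hZ.1) fun n Z hZ =>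
        (summable_norm_of_le_half_pow (hgeo n Z hZ)).of_norm,
        fun n => analyticOnNhd_tsum_level hR₁ hh (hb n)⟩,
      fun n Z hZ => norm_tsum_le_two (hgeo n Z hZ)⟩
    obtain ⟨N₀, hN₀⟩ := exists_pow_lt_of_lt_one (half_pos hη) (one_half_lt_one (α := ℝ))
    refine ⟨N₀, fun N hN n Z hZ => (norm_tsum_sub_sum_range_le (hgeo n Z hZ) N).trans_lt ?_⟩
    have : ((1 : ℝ) / 2) ^ N ≤ (1 / 2) ^ N₀ :=
      pow_le_pow_of_le_one (by norm_num) (by norm_num) hN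
    linarith
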